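/- **Model.** Let $\mathcal H_1=L^2(\mathbb R^d)$, let $H_1$ be multiplication by a measurable real function $\omega(k)$ bounded from below, $\beta>0$, $\omega_0\in\mathbb R$, $L=e^{-\beta H_1/2}$. Let $g_0,g_1\in\mathcal H_1$ and let $P_0$ be an orthogonal projection commuting with $H_1$ with $P_0g_0=g_0$, $P_0g_1=0$. Put $S_t=e^{it(H_1-\omega_0P_0)}$ and $P_E=\frac1{2\pi}\int S_te^{-itE}dt$ (in the sense of quadratic forms). Let $K$ be a subspace of the closed span of $\{S_tg_\varepsilon\}$ that contains $g_0,g_1$ and satisfies $\int|\langle f,S_tf'\rangle|dt<\infty$ for all $f,f'\in K$. Let $D$ be a bounded operator on the system Hilbert space $\mathcal H_S$, $D_0=D$, $D_1=D^+$ (the adjoint), and, for $\varepsilon\in\{0,1\}$, $$\gamma_\varepsilon(E)=\int_{-\infty}^0\langle g_\varepsilon,S_tg_\varepsilon\rangle e^{-itE}dt .$$ Assume that $1+\gamma_\varepsilon(E)\gamma_{1-\varepsilon}(E)D_\varepsilon D_{1-\varepsilon}$ is invertible for all $E\in\mathbb R$ and $\varepsilon\in\{0,1\}$, and let $T_\varepsilon(E)$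 be its inverse. **Master field.** Let $K\otimes_\beta K$ be the Hilbert space generated by the $f_0\otimes_\beta f_1$ (antilinear in $f_1$; $f_0,f_1\in K$) with $(f_0\otimes_\beta f_1|f_0'\otimes_\beta f_1')=\int\langle f_0,S_tf_0'\rangle\overline{\langle f_1,S_tL^2f_1'\rangle}dt$. On the exponential vectors $\psi(h)$ of the Fock space over $L^2(\mathbb R)\otimes (K\otimes_\beta K)$, $h$ a finite sum of terms $\varphi\otimes(f_0\otimes_\beta f_1)$ with $\varphi$ a Schwartz function and $f_0,f_1\in K$, the annihilators $B_{a,b}(E,t)$ ($a,b\in\{0,1\}$) act by $$B_{a,b}(E,t)\psi(h)=(g_a\otimes_\beta P_Eg_b\,|\,h(t))\,\psi(h).$$ (Only those $h$ are used for which these eigenvalues are integrable in $E$.) $B^+_{a,b}(E,t)$ are the corresponding creators, and $N_{a,b}(t)=\sum_{b'}\int dE\,n_{b'}(E)B^+_{a,b'}(E,t)B_{b,b'}(E,t)$ with $n_b(E)=1/\langle g_b,P_EL^2g_b\rangle$. An operator adapted to $[0,t]$ is described, on the vectors $u\otimes\psi(h)$, by its $\mathbf B(\mathcal H_S)$-valued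 coefficients at the time-ordered products $\prod_j n_{b_j}(E_j)B^+_{a_j,b_j}(E_j,t_j)$, $t>t_1>\dots>t_k>0$. A product $B_{a,b}(E,t)X$ with such an operator $X$ is the causal one: $B_{a,b}(E,t)$ is commuted through all creators in $X$ with the commutator $$[B_{a,b}(E,t),B^+_{a',b'}(E',t')]=\delta_{aa'}\delta_{bb'}\delta(E-E')\langle g_b,P_EL^2g_b\rangle\,\lambda^{-2}\langle g_a,S_{(t'-t)/\lambda^2}g_a\rangle e^{-i(t'-t)E/\lambda^2},$$ and then $\lambda\to0+$. Finally $B_{a,b}(t)=\int dE\,B_{a,b}(E,t)$ and $B^+_{a,b}(t)=\int dE\,B^+_{a,b}(E,t)$. **Evolution.** Let $U_t$ be an adapted process whose coefficients are continuous on the closed time simplices and which solves $$U_t=1-i\int_0^tH(s)U_s\,ds,\qquad H(t)=\sum_{\varepsilon=0,1}D_\varepsilon\otimes\bigl(N_{\varepsilon,1-\varepsilon}(t)+B_{1-\varepsilon,\varepsilon}(t)+B^+_{\varepsilon,1-\varepsilon}(t)\bigr),$$ with causal products, the coefficients of $B_{1-\varepsilon,\varepsilon}(E,t)U_t$ being integrable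 in $E$ and those of $H(s)U_s$ outside the creation part being integrable in $s$. **Theorem.** For every $t>0$ and $\varepsilon\in\{0,1\}$ the causal products $B_{a,b}(E,t)U_t$ exist, and $$-iD_\varepsilon[B_{1-\varepsilon,\varepsilon}(t),U_t]=-\int dE\,\gamma_{1-\varepsilon}(E)D_\varepsilon D_{1-\varepsilon}T_\varepsilon(E)\Bigl(\langle g_\varepsilon,P_EL^2g_\varepsilon\rangle U_t-iD_\varepsilon\gamma_\varepsilon(E)U_tB_{1-\varepsilon,\varepsilon}(E,t)+U_tB_{\varepsilon,\varepsilon}(E,t)\Bigr),$$ as an identity of the coefficients at all configurations with times in $(0,t)$ on every $\psi(h)$; the coefficients of $[B_{1-\varepsilon,\varepsilon}(E,t),U_t]$ and of the integrand on the right are integrable in $E$. -/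

import Mathlib

open MeasureTheory Filter Topology
open scoped InnerProductSpace

noncomputable section

namespace LowDensity

/-! ### The one-particle space and its free dynamics -/

/-- Momentum space `ℝᵈ`. -/
abbrev Momentum (d : ℕ) : Type := EuclideanSpace ℝ (Fin d)

/-- The one-particle Hilbert space `ℋ₁ = L²(ℝᵈ)`. -/
abbrev OneParticle (d : ℕ) : Type := Lp ℂ 2 (volume : Measure (Momentum d))

/-- A bounded measurable function on momentum space, as an element of `L^∞`. -/
theorem memLp_top_of_bounded {d : ℕ} {φ : Momentum d → ℂ} (hφ : Measurable φ) {C : ℝ}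
    (hC : ∀ k, ‖φ k‖ ≤ C) : MemLp φ ⊤ (volume : Measure (Momentum d)) :=
  memLp_top_of_bound hφ.aestronglyMeasurable C (Eventually.of_forall hC)

/-- The multiplication operator by a function of class `L^∞`, acting on `L²(ℝᵈ)`. -/
def mulOp {d : ℕ} {φ : Momentum d → ℂ} (hφ : MemLp φ ⊤ (volume : Measure (Momentum d)))
    (g : OneParticle d) : OneParticle d :=
  hφ.toLp φ • g

/-- The dispersion law `ω` of the reservoir particles: the one-particle Hamiltonian `H₁` is the
operator of multiplication by `ω(k)`; it is bounded from below. -/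
structure Dispersion (d : ℕ) where
  ω : Momentum d → ℝ
  measurable_ω : Measurable ω
  bddBelow_ω : ∃ c : ℝ, ∀ k, c ≤ ω k

namespace Dispersion

variable {d : ℕ}

theorem memLp_phase (w : Dispersion d) (t : ℝ) :
    MemLp (fun k => Complex.exp (Complex.I * (t * w.ω k : ℝ))) ⊤
      (volume : Measure (Momentum d)) := by
  have hω := w.measurable_ω
  refine memLp_top_of_bounded (by fun_prop) (C := 1) (fun k => ?_)
  rw [mul_comm, Complex.norm_exp_ofReal_mul_I]

theorem memLp_gibbs (w : Dispersion d) {β : ℝ} (hβ : 0 < β) :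
    MemLp (fun k => ((Real.exp (-β * w.ω k) : ℝ) : ℂ)) ⊤
      (volume : Measure (Momentum d)) := by
  have hω := w.measurable_ω
  obtain ⟨c, hc⟩ := w.bddBelow_ω
  refine memLp_top_of_bounded (by fun_prop) (C := Real.exp (-β * c)) (fun k => ?_)
  rw [Complex.norm_real, Real.norm_eq_abs, abs_of_pos (Real.exp_pos _)]
  exact Real.exp_le_exp.mpr (by nlinarith [hc k])

/-- The free evolution `S⁰_t = exp(i t H₁)`. -/
def free (w : Dispersion d) (t : ℝ) (g : OneParticle d) : OneParticle d :=
  mulOp (w.memLp_phase t) g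

/-- The operator `L² = exp(-β H₁)`, the square of `L = exp(-β H₁ / 2)`. -/
def gibbs (w : Dispersion d) {β : ℝ} (hβ : 0 < β) (g : OneParticle d) : OneParticle d :=
  mulOp (w.memLp_gibbs hβ) g

/-- The modified evolution `S_t = exp(i t (H₁ - ω₀ P₀)) = S⁰_t exp(-i t ω₀ P₀)`, for a projection
`P₀` that commutes with `H₁`; here `exp(-i t ω₀ P₀) = 1 + (exp(-i t ω₀) - 1) P₀`. -/
def shifted (w : Dispersion d) (ω₀ : ℝ) (P₀ : OneParticle d →L[ℂ] OneParticle d) (t : ℝ)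
    (g : OneParticle d) : OneParticle d :=
  w.free t (g + (Complex.exp (-(Complex.I * (t * ω₀ : ℝ))) - 1) • P₀ g)

end Dispersion

/-! ### The model -/

/-- The data of the model: a system with Hilbert space `HS`, coupled to a Bose gas over
`L²(ℝᵈ)` by `D ⊗ A⁺(g₀) A(g₁) + D⁺ ⊗ A⁺(g₁) A(g₀)`. -/
structure Model (d : ℕ) (HS : Type*) [NormedAddCommGroup HS] [InnerProductSpace ℂ HS]
    [CompleteSpace HS] extends Dispersion d where
  /-- the inverse temperature -/
  β : ℝ
  β_pos : 0 < β
  /-- the system frequency in the rotating wave condition -/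
  ω₀ : ℝ
  /-- the form factors `g₀`, `g₁` -/
  g : Fin 2 → OneParticle d
  /-- the projection that separates the two form factors; it commutes with `H₁` -/
  P₀ : OneParticle d →L[ℂ] OneParticle d
  isStarProjection_P₀ : IsStarProjection P₀
  P₀_commute : ∀ t f, P₀ (toDispersion.free t f) = toDispersion.free t (P₀ f)
  P₀_g_zero : P₀ (g 0) = g 0
  P₀_g_one : P₀ (g 1) = 0
  /-- a subspace of the closed span of the `S_t g_ε`, containing the form factors, on which
  time correlations are integrable -/
  K : Submodule ℂ (OneParticle d)
  K_le : K ≤ (Submodule.span ℂ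
    (Set.range fun p : ℝ × Fin 2 => toDispersion.shifted ω₀ P₀ p.1 (g p.2))).topologicalClosure
  g_mem : ∀ ε, g ε ∈ K
  integrable_corr : ∀ f ∈ K, ∀ f' ∈ K,
    Integrable fun t : ℝ => ⟪f, toDispersion.shifted ω₀ P₀ t f'⟫_ℂ
  /-- the system operator in the interaction -/
  D₀ : HS →L[ℂ] HS

namespace Model

variable {d : ℕ} {HS : Type*} [NormedAddCommGroup HS] [InnerProductSpace ℂ HS] [CompleteSpace HS]

/-- `D_0 = D`, `D_1 = D⁺`. -/
def D (M : Model d HS) (ε : Fin 2) : HS →L[ℂ] HS :=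
  if ε = 0 then M.D₀ else ContinuousLinearMap.adjoint M.D₀

/-- The group `S_t`. -/
def S (M : Model d HS) (t : ℝ) (f : OneParticle d) : OneParticle d :=
  M.toDispersion.shifted M.ω₀ M.P₀ t f

/-- The operator `L² = exp(-β H₁)`. -/
def Lsq (M : Model d HS) (f : OneParticle d) : OneParticle d :=
  M.toDispersion.gibbs M.β_pos f

/-- The energy density `⟨u, P_E v⟩`, where `P_E = (1/2π) ∫ S_t exp(-i t E) dt`. (For `u ∈ K` and
`v = f ∈ K` or `v = L² g_ε`, the integrand is integrable.) -/
def density (M : Model d HS) (u v : OneParticle d) (E : ℝ) : ℂ :=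
  (1 / (2 * Real.pi) : ℂ) * ∫ t : ℝ, ⟪u, M.S t v⟫_ℂ * Complex.exp (-(Complex.I * (t * E : ℝ)))

/-- `γ_ε(E) = ∫_{-∞}^0 ⟨g_ε, S_t g_ε⟩ exp(-i t E) dt`. -/
def γ (M : Model d HS) (ε : Fin 2) (E : ℝ) : ℂ :=
  ∫ t in Set.Iic (0 : ℝ), ⟪M.g ε, M.S t (M.g ε)⟫_ℂ * Complex.exp (-(Complex.I * (t * E : ℝ)))

/-- `⟨g_ε, P_E L² g_ε⟩`. -/
def m (M : Model d HS) (ε : Fin 2) (E : ℝ) : ℂ :=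
  M.density (M.g ε) (M.Lsq (M.g ε)) E

/-- The operator `1 + γ_ε(E) γ_{1-ε}(E) D_ε D_{1-ε}`. -/
def preT (M : Model d HS) (ε : Fin 2) (E : ℝ) : HS →L[ℂ] HS :=
  1 + (M.γ ε E * M.γ (1 - ε) E) • (M.D ε * M.D (1 - ε))

/-- `T_ε(E)`, the inverse of `1 + γ_ε(E) γ_{1-ε}(E) D_ε D_{1-ε}` (used where it exists). -/
def T (M : Model d HS) (ε : Fin 2) (E : ℝ) : HS →L[ℂ] HS :=
  Ring.inverse (M.preT ε E)

/-! ### Exponential vectors and the master field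

The limit reservoir space is the Fock space over `L²(ℝ) ⊗ K_{0,1}`, `K_{0,1} = K ⊗_β K`, with scalar
product `(f₀ ⊗ f₁ | f₀' ⊗ f₁') = ∫ ⟨f₀, S_t f₀'⟩ conj ⟨f₁, S_t L² f₁'⟩ dt`, and
`B_{a,b}(E,t) = b_t(g_a ⊗_β P_E g_b)` are its white noise annihilators. -/

/-- The value `(g_a ⊗_β P_E g_b | h(t)) = 2π ∑ φ(t) ⟨g_a, P_E f₀⟩ ⟨f₁, P_E L² g_b⟩` for the finite
sum `h = ∑ φ ⊗ (f₀ ⊗_β f₁)`. -/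
def pairing (M : Model d HS) (l : List (SchwartzMap ℝ ℂ × M.K × M.K)) (a b : Fin 2) (E t : ℝ) : ℂ :=
  (2 * Real.pi : ℂ) * (l.map fun p =>
    p.1 t * M.density (M.g a) p.2.1 E * M.density p.2.2 (M.Lsq (M.g b)) E).sum

/-- Test functions `h = ∑ φ ⊗ (f₀ ⊗_β f₁)`, that is, elements of the algebraic tensor product of
the Schwartz space with `K ⊗_β K`, that label the exponential vectors `ψ(h)`; `ψ(h)` lies in the
domain of `B_{a,b}(t) = ∫ dE B_{a,b}(E,t)`. -/
structure TestFunction (M : Model d HS) where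
  terms : List (SchwartzMap ℝ ℂ × M.K × M.K)
  integrable : ∀ a b t, Integrable fun E : ℝ => M.pairing terms a b E t

/-- The eigenvalue in `B_{a,b}(E,t) ψ(h) = h_{a,b}(E,t) ψ(h)`. -/
def TestFunction.val {M : Model d HS} (h : M.TestFunction) (a b : Fin 2) (E t : ℝ) : ℂ :=
  M.pairing h.terms a b E t

end Model

/-- A mode `(a, b, E)` of the master field: the index of `B_{a,b}(E,·)`. -/
structure Mode where
  a : Fin 2
  b : Fin 2
  E : ℝ

/-- A finite configuration of time-labelled modes, latest time first. -/
abbrev Config : Type := List (Mode × ℝ)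

/-- Insertion of a time-labelled mode at its chronological place. -/
def Config.insert (x : Mode) (s : ℝ) (σ : Config) : Config :=
  List.orderedInsert (fun p q : Mode × ℝ => q.2 ≤ p.2) (x, s) σ

/-- The times of a configuration lie in `(0, t)` and are strictly decreasing. -/
def Config.Before (t : ℝ) (σ : Config) : Prop :=
  σ.Pairwise (fun p q => q.2 < p.2) ∧ ∀ p ∈ σ, 0 < p.2 ∧ p.2 < t

namespace Model

variable {d : ℕ} {HS : Type*} [NormedAddCommGroup HS] [InnerProductSpace ℂ HS] [CompleteSpace HS]

/-- Operators on `HS ⊗ Fock`, given by their action on exponential vectors in chronologically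
ordered form. A kernel `X` stands for the operator with
`X (u ⊗ ψ(h)) = ∑_k ∑ ∫ X h [(x_1,t_1),…,(x_k,t_k)] u ⊗ c⁺(x_1,t_1) ⋯ c⁺(x_k,t_k) ψ(h)`,
the inner sums and integrals being over modes `x_j = (a_j, b_j, E_j)` and over times
`t_1 > ⋯ > t_k > 0`. Here `c⁺_{a,b}(E,t) = n_b(E) B⁺_{a,b}(E,t)` with
`n_b(E) = 1 / ⟨g_b, P_E L² g_b⟩`, so that
`B⁺_{a,b}(E,t) = ⟨g_b, P_E L² g_b⟩ c⁺_{a,b}(E,t)`. -/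
abbrev Kernel (M : Model d HS) : Type _ := M.TestFunction → Config → (HS →L[ℂ] HS)

/-- The kernel of the identity. -/
def one (M : Model d HS) : M.Kernel := fun _ σ => if σ = [] then 1 else 0

/-- The commutator function of `B_{a,b}(E,t)` and `c⁺_{a,b}(E',t + s)` before the limit, apart from
the factor `δ(E - E')`:
`λ⁻² ⟨g_a, S_{s/λ²} g_a⟩ exp(-i s E / λ²) = ∫ dE₁ λ⁻² exp(i s (E₁ - E) / λ²) ⟨g_a, P_{E₁} g_a⟩`.
For different indices the commutator vanishes, as `⟨g_0, S_t g_1⟩ = 0` and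
`⟨g_0, S_t L² g_1⟩ = 0`. -/
def commutatorFun (M : Model d HS) (a : Fin 2) (E lam s : ℝ) : ℂ :=
  ((lam ^ 2)⁻¹ : ℝ) * ⟪M.g a, M.S (s / lam ^ 2) (M.g a)⟫_ℂ *
    Complex.exp (-(Complex.I * (s / lam ^ 2 * E : ℝ)))

/-- The product of `B_{a,b}(E,t)` from the left with an operator `X` that is adapted to `[0,t]`,
before the limit: `B_{a,b}(E,t)` is commuted through all the creators in `X`, at whatever place in
the chronological product, and then acts on `ψ(h)`. -/
def annLeftReg (M : Model d HS) (lam : ℝ) (a b : Fin 2) (E t : ℝ) (X : M.Kernel) : M.Kernel :=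
  fun h σ => (∫ s in (0 : ℝ)..t, M.commutatorFun a E lam (s - t) • X h (σ.insert ⟨a, b, E⟩ s))
    + h.val a b E t • X h σ

/-- The causal product `B_{a,b}(E,t) X`: the limit `λ → 0+` of the preceding product, in which the
commutator functions are distributions over the simplex. -/
def annLeft (M : Model d HS) (a b : Fin 2) (E t : ℝ) (X : M.Kernel) : M.Kernel :=
  fun h σ => limUnder (𝓝[>] (0 : ℝ)) fun lam => M.annLeftReg lam a b E t X h σ

/-- The product `X B_{a,b}(E,t)`. -/
def annRight (M : Model d HS) (a b : Fin 2) (E t : ℝ) (X : M.Kernel) : M.Kernel :=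
  fun h σ => h.val a b E t • X h σ

/-- `B_{a,b}(t) X = ∫ dE B_{a,b}(E,t) X`. -/
def annLeftTotal (M : Model d HS) (a b : Fin 2) (t : ℝ) (X : M.Kernel) : M.Kernel :=
  fun h σ => ∫ E : ℝ, M.annLeft a b E t X h σ

/-- `X B_{a,b}(t) = ∫ dE X B_{a,b}(E,t)`. -/
def annRightTotal (M : Model d HS) (a b : Fin 2) (t : ℝ) (X : M.Kernel) : M.Kernel :=
  fun h σ => ∫ E : ℝ, M.annRight a b E t X h σ

/-! ### The limiting Hamiltonian and the equation for the evolution operator -/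

/-- White noise expressions at a time `t`: a pair `(C, Y)` stands for
`∑_{a,b} ∫ dE c⁺_{a,b}(E,t) C(a,b,E) + Y`, with operators `C(a,b,E)` and `Y` adapted to
`[0,t]`. -/
abbrev WhiteNoise (M : Model d HS) : Type _ := (Mode → M.Kernel) × M.Kernel

/-- Multiplication of a white noise expression by a system operator. -/
def sysMul (M : Model d HS) (A : HS →L[ℂ] HS) (Z : M.WhiteNoise) : M.WhiteNoise :=
  (fun x h σ => A * Z.1 x h σ, fun h σ => A * Z.2 h σ)

/-- `B⁺_{c,e}(t) X = ∫ dE B⁺_{c,e}(E,t) X`. -/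
def creation (M : Model d HS) (c e : Fin 2) (_t : ℝ) (X : M.Kernel) : M.WhiteNoise :=
  (fun x h σ => if x.a = c ∧ x.b = e then M.m e x.E • X h σ else 0, 0)

/-- `N_{c,e}(t) X = ∑_b ∫ dE n_b(E) B⁺_{c,b}(E,t) B_{e,b}(E,t) X`. -/
def number (M : Model d HS) (c e : Fin 2) (t : ℝ) (X : M.Kernel) : M.WhiteNoise :=
  (fun x h σ => if x.a = c then M.annLeft e x.b x.E t X h σ else 0, 0)

/-- `B_{c,e}(t) X`, as a white noise expression. -/
def annihilation (M : Model d HS) (c e : Fin 2) (t : ℝ) (X : M.Kernel) : M.WhiteNoise :=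
  (0, M.annLeftTotal c e t X)

/-- `H(t) X`, for the limiting Hamiltonian
`H(t) = ∑_ε D_ε ⊗ (N_{ε,1-ε}(t) + B_{1-ε,ε}(t) + B⁺_{ε,1-ε}(t))`. -/
def hamiltonian (M : Model d HS) (t : ℝ) (X : M.Kernel) : M.WhiteNoise :=
  ∑ ε : Fin 2, M.sysMul (M.D ε)
    (M.number ε (1 - ε) t X + M.annihilation (1 - ε) ε t X + M.creation ε (1 - ε) t X)

/-- The kernel of `∫_0^t Z_s ds` at configurations with times in `(0,t]`. The latest creator comes
from the creation part of `Z_s` at its own time `s`, or the whole configuration comes from the rest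
of `Z_r` at a later time `r`. -/
def timeIntegral (M : Model d HS) (Z : ℝ → M.WhiteNoise) (t : ℝ) : M.Kernel
  | h, [] => ∫ r in (0 : ℝ)..t, (Z r).2 h []
  | h, (x, s) :: σ => (Z s).1 x h σ + ∫ r in s..t, (Z r).2 h ((x, s) :: σ)

/-- `U` is an evolution operator of the limiting model: an adapted process, continuous up to the
boundary of the time simplex, with `U_t = 1 - i ∫_0^t H(s) U_s ds`, where `H(s) U_s` and its time
integral are well defined. -/
structure IsEvolution (M : Model d HS) (U : ℝ → M.Kernel) : Prop where
  continuousOn : ∀ (h : M.TestFunction) (n : ℕ) (x : Fin n → Mode),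
    ContinuousOn
      (fun p : ℝ × (Fin n → ℝ) => U p.1 h (List.ofFn fun i => (x i, p.2 i)))
      {p | 0 ≤ p.1 ∧ Antitone p.2 ∧ ∀ i, 0 ≤ p.2 i ∧ p.2 i ≤ p.1}
  integrable : ∀ (h : M.TestFunction) (ε : Fin 2) (t : ℝ), 0 < t → ∀ σ : Config, σ.Before t →
    Integrable fun E : ℝ => M.annLeft (1 - ε) ε E t (U t) h σ
  intervalIntegrable_nil : ∀ (h : M.TestFunction) (t : ℝ), 0 ≤ t →
    IntervalIntegrable (fun r => (M.hamiltonian r (U r)).2 h []) volume 0 t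
  intervalIntegrable_cons : ∀ (h : M.TestFunction) (x : Mode) (s t : ℝ), 0 < s → s ≤ t →
    ∀ σ : Config, σ.Before s →
    IntervalIntegrable (fun r => (M.hamiltonian r (U r)).2 h ((x, s) :: σ)) volume s t
  equation_nil : ∀ (h : M.TestFunction) (t : ℝ), 0 ≤ t →
    U t h [] = M.one h [] -
      Complex.I • M.timeIntegral (fun r => M.hamiltonian r (U r)) t h []
  equation_cons : ∀ (h : M.TestFunction) (x : Mode) (s t : ℝ), 0 < s → s ≤ t →
    ∀ σ : Config, σ.Before s →
    U t h ((x, s) :: σ) = M.one h ((x, s) :: σ) -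
      Complex.I • M.timeIntegral (fun r => M.hamiltonian r (U r)) t h ((x, s) :: σ)

/-- The integrand of the normally ordered form,
`γ_{1-ε}(E) D_ε D_{1-ε} T_ε(E) (⟨g_ε, P_E L² g_ε⟩ X - i D_ε γ_ε(E) X B_{1-ε,ε}(E,t)
+ X B_{ε,ε}(E,t))`. -/
def normalOrdered (M : Model d HS) (ε : Fin 2) (E t : ℝ) (X : M.Kernel) : M.Kernel :=
  fun h σ => (M.γ (1 - ε) E • (M.D ε * M.D (1 - ε) * M.T ε E)) *
    (M.m ε E • X h σ
      - Complex.I • (M.D ε * (M.γ ε E • M.annRight (1 - ε) ε E t X h σ))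
      + M.annRight ε ε E t X h σ)

end Model

end LowDensity

end

/-!
The commutator of `B_{a,b}(E,t)` with a creator at time `s < t` of the same mode is an approximate
identity in `s`, concentrating at `s = t` from the left with mass `γ_a(E)`
(`tendsto_integral_approx_identity_left`). The coefficients of `U_t` with one creator inserted at a
variable time are bounded, measurable and have a boundary value at `t`
(`aestronglyMeasurable_bounded_insert`, `tendsto_insert_left`), so the causal product exists and is
`γ_a(E) U_t((a,b,E),t; σ) + h_{a,b}(E,t) U_t(σ)` (`IsEvolution.annLeft_eq`).

The evolution equation at a latest creation time equal to `t` expresses this boundary value in turn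
through a causal product with the first index flipped (`IsEvolution.apply_final_time`), since the
time integral is then empty. For fixed `E` the unknowns `B_{1-ε,ε}(E,t) U_t` and `B_{ε,ε}(E,t) U_t`
thus satisfy a closed linear system, and elimination of the second one leaves `D_ε` times the
commutator multiplied by `1 + γ_ε γ_{1-ε} D_ε D_{1-ε}`, which `T_ε(E)` inverts
(`IsEvolution.normalOrdered_eq`). Both sides of the theorem are therefore equal for each `E`, and
the integrability of the right-hand side is inherited from the commutator.
-/

namespace LowDensity

/-! ### A one-sided approximate identity -/

/-- If `φ` is integrable on `(-∞, 0]`, the kernels `c⁻² φ((s - t) / c²)` on `(0, t)` converge to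
`(∫_{-∞}^0 φ) δ_{t-}` when `c → 0+`. -/
theorem tendsto_integral_approx_identity_left {E : Type*} [NormedAddCommGroup E] [NormedSpace ℂ E]
    [CompleteSpace E] {φ : ℝ → ℂ} (hφ : IntegrableOn φ (Set.Iic 0)) {F : ℝ → E} {t : ℝ} (ht : 0 < t) {C : ℝ}
    (hF : AEStronglyMeasurable F (volume.restrict (Set.Ioo 0 t)))
    (hC : ∀ s ∈ Set.Ioo 0 t, ‖F s‖ ≤ C) {y : E} (hy : Tendsto F (𝓝[<] t) (𝓝 y)) :
    Tendsto (fun c : ℝ => ∫ s in (0 : ℝ)..t, (((c ^ 2)⁻¹ : ℝ) * φ ((s - t) / c ^ 2)) • F s)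
      (𝓝[>] 0) (𝓝 ((∫ u in Set.Iic (0 : ℝ), φ u) • y)) := by
  set G : ℝ → E := (Set.Ioo 0 t).indicator F with hG
  set ψ : ℝ → ℂ := (Set.Iic 0).indicator φ with hψ
  have hψi : Integrable ψ := (integrable_indicator_iff measurableSet_Iic).2 hφ
  have hGi : Integrable G := by
    rw [hG, integrable_indicator_iff measurableSet_Ioo]
    exact IntegrableOn.of_bound measure_Ioo_lt_top hF C
      ((ae_restrict_iff' measurableSet_Ioo).2 (ae_of_all _ hC))
  have hC0 : 0 ≤ C := (norm_nonneg _).trans (hC (t / 2) ⟨by linarith, by linarith⟩)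
  have hGC : ∀ s, ‖G s‖ ≤ C := fun s => by
    by_cases hs : s ∈ Set.Ioo 0 t
    · rw [hG, Set.indicator_of_mem hs]; exact hC s hs
    · rw [hG, Set.indicator_of_notMem hs, norm_zero]; exact hC0
  have hGcomp : ∀ c : ℝ, c ≠ 0 → Integrable fun u => G (t + c ^ 2 * u) := fun c hc =>
    (hGi.comp_add_left t).comp_mul_left' (pow_ne_zero 2 hc)
  have hsubst : ∀ c : ℝ, 0 < c →
      ∫ s in (0 : ℝ)..t, (((c ^ 2)⁻¹ : ℝ) * φ ((s - t) / c ^ 2)) • F s =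
        ∫ u, ψ u • G (t + c ^ 2 * u) := fun c hc => by
    have hc2 : 0 < c ^ 2 := by positivity
    have h1 := integral_add_left_eq_self (μ := (volume : Measure ℝ))
      (fun s => ψ ((s - t) / c ^ 2) • G s) t
    have h2 := Measure.integral_comp_mul_left (fun s => ψ ((t + s - t) / c ^ 2) • G (t + s)) (c ^ 2)
    rw [h1, abs_of_pos (inv_pos.2 hc2)] at h2
    have h3 : (fun u => ψ u • G (t + c ^ 2 * u)) =
        fun x => ψ ((t + c ^ 2 * x - t) / c ^ 2) • G (t + c ^ 2 * x) := by
      funext x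
      congr 2
      field_simp
      ring
    rw [h3, h2, intervalIntegral.integral_of_le ht.le, integral_Ioc_eq_integral_Ioo,
      ← integral_smul, ← integral_indicator measurableSet_Ioo]
    congr 1
    funext s
    by_cases hs : s ∈ Set.Ioo 0 t
    · have hs' : (s - t) / c ^ 2 ∈ Set.Iic (0 : ℝ) :=
        div_nonpos_of_nonpos_of_nonneg (by linarith [hs.2]) hc2.le
      rw [Set.indicator_of_mem hs, hψ, Set.indicator_of_mem hs', hG, Set.indicator_of_mem hs,
        mul_smul, Complex.coe_smul]
    · rw [Set.indicator_of_notMem hs, hG, Set.indicator_of_notMem hs, smul_zero, smul_zero]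
  have hlim : Tendsto (fun c : ℝ => ∫ u, ψ u • G (t + c ^ 2 * u)) (𝓝[>] 0)
      (𝓝 (∫ u, ψ u • y)) := by
    refine tendsto_integral_filter_of_dominated_convergence (fun u => ‖ψ u‖ * C) ?_ ?_
      (hψi.norm.mul_const C) ?_
    · filter_upwards [self_mem_nhdsWithin] with c hc
      exact hψi.aestronglyMeasurable.smul (hGcomp c (ne_of_gt hc)).aestronglyMeasurable
    · refine Eventually.of_forall fun c => ae_of_all _ fun u => ?_
      rw [norm_smul]
      exact mul_le_mul_of_nonneg_left (hGC _) (norm_nonneg _)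
    · filter_upwards [Measure.ae_ne volume (0 : ℝ)] with u hu
      rcases lt_or_gt_of_ne hu with hu | hu
      · refine Tendsto.const_smul ?_ _
        have h0 : Tendsto (fun c : ℝ => t + c ^ 2 * u) (𝓝[>] 0) (𝓝[<] t) := by
          refine tendsto_nhdsWithin_iff.2 ⟨?_, ?_⟩
          · have : Continuous fun c : ℝ => t + c ^ 2 * u := by fun_prop
            simpa using (this.tendsto 0).mono_left nhdsWithin_le_nhds
          · filter_upwards [self_mem_nhdsWithin] with c hc
            have : c ^ 2 * u < 0 := mul_neg_of_pos_of_neg (pow_pos hc 2) hu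
            simpa using this
        have hGF : G =ᶠ[𝓝[<] t] F := by
          filter_upwards [Ioo_mem_nhdsLT ht] with s hs
          exact Set.indicator_of_mem hs F
        exact (hy.congr' hGF.symm).comp h0
      · have : ψ u = 0 := Set.indicator_of_notMem (by simpa using hu) _
        simp [this]
  rw [integral_smul_const, hψ, integral_indicator measurableSet_Iic] at hlim
  refine hlim.congr' ?_
  filter_upwards [self_mem_nhdsWithin] with c hc
  exact (hsubst c hc).symm

/-! ### Insertion of a creator into a chronological product -/

section Insertion

variable {E : Type*} [NormedAddCommGroup E]

/-- The restriction of continuity on closed time simplices to the motion of a single time. -/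
theorem continuousOn_move_time {f : Config → E} {t : ℝ}
    (hf : ∀ (n : ℕ) (x : Fin n → Mode),
      ContinuousOn (fun p : Fin n → ℝ => f (List.ofFn fun i => (x i, p i)))
        {p | Antitone p ∧ ∀ i, 0 ≤ p i ∧ p i ≤ t})
    (τ ρ : Config) (x : Mode) {I : Set ℝ}
    (hI : ∀ s ∈ I, (τ ++ (x, s) :: ρ).Pairwise (fun p q => q.2 ≤ p.2) ∧
      ∀ p ∈ τ ++ (x, s) :: ρ, 0 ≤ p.2 ∧ p.2 ≤ t) :
    ContinuousOn (fun s => f (τ ++ (x, s) :: ρ)) I := by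
  have hlen : ∀ s, (τ ++ (x, s) :: ρ).length = τ.length + (ρ.length + 1) := by simp
  let c : Fin (τ.length + (ρ.length + 1)) → Mode := fun i =>
    ((τ ++ (x, (0 : ℝ)) :: ρ)[i.1]'(by rw [hlen]; exact i.2)).1
  let p : ℝ → Fin (τ.length + (ρ.length + 1)) → ℝ := fun s i =>
    ((τ ++ (x, s) :: ρ)[i.1]'(by rw [hlen]; exact i.2)).2
  have hofFn : ∀ s, (List.ofFn fun i => (c i, p s i)) = τ ++ (x, s) :: ρ := fun s => by
    refine List.ext_getElem (by simp [add_assoc]) fun i h1 h2 => ?_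
    simp only [c, p, List.getElem_ofFn, List.getElem_append, List.getElem_cons]
    split_ifs <;> rfl
  have hp : Continuous p := by
    refine continuous_pi fun i => ?_
    simp only [p, List.getElem_append, List.getElem_cons]
    split_ifs
    · exact continuous_const
    · exact (continuous_id : Continuous fun s : ℝ => s)
    -- The bound in `ρ[_]` depends on the time, so this is constant only up to proof irrelevance.
    · exact continuous_of_const fun _ _ => rfl
  refine ((hf _ c).comp hp.continuousOn fun s hs => ⟨?_, fun i => ?_⟩).congr
    fun s _ => congrArg f (hofFn s).symm
  · intro i j hij
    rcases hij.eq_or_lt with rfl | hij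
    · exact le_rfl
    · exact List.pairwise_iff_getElem.1 (hI s hs).1 i j _ _ hij
  · exact (hI s hs).2 _ (List.getElem_mem _)

/-- The coefficient of a chronological product with one creator inserted at a variable time is
bounded and measurable: it is continuous between two consecutive times of the product. -/
theorem aestronglyMeasurable_bounded_insert {f : Config → E} {t : ℝ}
    (hf : ∀ (n : ℕ) (x : Fin n → Mode),
      ContinuousOn (fun p : Fin n → ℝ => f (List.ofFn fun i => (x i, p i)))
        {p | Antitone p ∧ ∀ i, 0 ≤ p i ∧ p i ≤ t}) (x : Mode) :
    ∀ (ρ τ : Config) (b : ℝ), b ≤ t →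
      (τ ++ ρ).Pairwise (fun p q => q.2 ≤ p.2) → (∀ p ∈ τ ++ ρ, 0 ≤ p.2 ∧ p.2 ≤ t) →
      (∀ p ∈ τ, b ≤ p.2) → (∀ p ∈ ρ, p.2 ≤ b) →
      AEStronglyMeasurable (fun s => f (τ ++ ρ.insert x s)) (volume.restrict (Set.Ioo 0 b)) ∧
        ∃ C, ∀ s ∈ Set.Ioo 0 b, ‖f (τ ++ ρ.insert x s)‖ ≤ C := by
  intro ρ
  induction ρ with
  | nil =>
    intro τ b hb hpw hmem hτ _
    have hcont : ContinuousOn (fun s => f (τ ++ [(x, s)])) (Set.Icc 0 b) :=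
      continuousOn_move_time hf τ [] x fun s hs => by
        refine ⟨?_, ?_⟩
        · simp only [List.append_nil] at hpw
          refine List.pairwise_append.2 ⟨hpw, by simp, ?_⟩
          simpa using fun a c hac => hs.2.trans (hτ _ hac)
        · intro p hp
          rcases List.mem_append.1 hp with hp | hp
          · exact hmem p (by simpa using hp)
          · rw [List.mem_singleton.1 hp]
            exact ⟨hs.1, hs.2.trans hb⟩
    obtain ⟨C, hC⟩ := isCompact_Icc.exists_bound_of_continuousOn hcont
    exact ⟨(hcont.mono Set.Ioo_subset_Icc_self).aestronglyMeasurable measurableSet_Ioo,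
      C, fun s hs => hC s (Set.Ioo_subset_Icc_self hs)⟩
  | cons q ρ ih =>
    intro τ b hb hpw hmem hτ hρ
    have hq := hmem q (by simp)
    have hqb : q.2 ≤ b := hρ q (by simp)
    have hpw' := List.pairwise_append.1 hpw
    have hqρ : ∀ p ∈ ρ, p.2 ≤ q.2 := (List.pairwise_cons.1 hpw'.2.1).1
    obtain ⟨hm, C, hC⟩ := ih (τ ++ [q]) q.2 hq.2 (by simpa using hpw) (by simpa using hmem)
      (fun p hp => by
        rcases List.mem_append.1 hp with hp | hp
        · exact hqb.trans (hτ p hp)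
        · rw [List.mem_singleton.1 hp])
      hqρ
    have hcont : ContinuousOn (fun s => f (τ ++ (x, s) :: q :: ρ)) (Set.Icc q.2 b) :=
      continuousOn_move_time hf τ (q :: ρ) x fun s hs => by
        refine ⟨List.pairwise_append.2 ⟨hpw'.1, List.pairwise_cons.2 ⟨?_, hpw'.2.1⟩, ?_⟩, ?_⟩
        · intro p hp
          rcases List.mem_cons.1 hp with rfl | hp
          · exact hs.1
          · exact (hqρ p hp).trans hs.1
        · intro p hp r hr
          rcases List.mem_cons.1 hr with rfl | hr
          · exact hs.2.trans (hτ p hp)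
          · exact hpw'.2.2 p hp r hr
        · intro p hp
          rcases List.mem_append.1 hp with hp | hp
          · exact hmem p (List.mem_append_left _ hp)
          · rcases List.mem_cons.1 hp with rfl | hp
            · exact ⟨hq.1.trans hs.1, hs.2.trans hb⟩
            · exact hmem p (List.mem_append_right _ hp)
    obtain ⟨C', hC'⟩ := isCompact_Icc.exists_bound_of_continuousOn hcont
    have hlo : ∀ s ∈ Set.Ioo 0 q.2,
        f (τ ++ Config.insert x s (q :: ρ)) = f (τ ++ [q] ++ Config.insert x s ρ) := fun s hs => by
      simp [Config.insert, List.orderedInsert_cons, not_le.2 hs.2]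
    have hhi : ∀ s ∈ Set.Ico q.2 b,
        f (τ ++ Config.insert x s (q :: ρ)) = f (τ ++ (x, s) :: q :: ρ) := fun s hs => by
      simp [Config.insert, List.orderedInsert_cons, hs.1]
    have hcover : ∀ s ∈ Set.Ioo 0 b, s ∈ Set.Ioo 0 q.2 ∨ s ∈ Set.Ico q.2 b := fun s hs =>
      (lt_or_ge s q.2).imp (fun h => ⟨hs.1, h⟩) fun h => ⟨h, hs.2⟩
    refine ⟨?_, max C C', fun s hs => ?_⟩
    · refine AEStronglyMeasurable.mono_set (t := Set.Ioo 0 q.2 ∪ Set.Ico q.2 b) hcover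
        (aestronglyMeasurable_union_iff.2 ⟨?_, ?_⟩)
      · exact hm.congr ((ae_restrict_iff' measurableSet_Ioo).2
          (ae_of_all _ fun s hs => (hlo s hs).symm))
      · exact ((hcont.mono Set.Ico_subset_Icc_self).aestronglyMeasurable
          measurableSet_Ico).congr ((ae_restrict_iff' measurableSet_Ico).2
          (ae_of_all _ fun s hs => (hhi s hs).symm))
    · rcases hcover s hs with h | h
      · rw [hlo s h]
        exact (hC s h).trans (le_max_left _ _)
      · rw [hhi s h]
        exact (hC' s (Set.Ico_subset_Icc_self h)).trans (le_max_right _ _)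

/-- A creator inserted just before `t` is the latest one, so that its coefficient has a boundary
value at `t`. -/
theorem tendsto_insert_left {f : Config → E} {t : ℝ} (ht : 0 < t)
    (hf : ∀ (n : ℕ) (x : Fin n → Mode),
      ContinuousOn (fun p : Fin n → ℝ => f (List.ofFn fun i => (x i, p i)))
        {p | Antitone p ∧ ∀ i, 0 ≤ p i ∧ p i ≤ t}) (x : Mode) {σ : Config} (hσ : σ.Before t) :
    Tendsto (fun s => f (σ.insert x s)) (𝓝[<] t) (𝓝 (f ((x, t) :: σ))) := by
  obtain ⟨b, hb0, hbt, hb⟩ : ∃ b, 0 ≤ b ∧ b < t ∧ ∀ p ∈ σ, p.2 ≤ b := by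
    cases σ with
    | nil => exact ⟨0, le_rfl, ht, by simp⟩
    | cons q ρ =>
      have hq := hσ.2 q (by simp)
      refine ⟨q.2, hq.1.le, hq.2, fun p hp => ?_⟩
      rcases List.mem_cons.1 hp with rfl | hp
      · exact le_rfl
      · exact ((List.pairwise_cons.1 hσ.1).1 p hp).le
  have hcont : ContinuousOn (fun s => f ([] ++ (x, s) :: σ)) (Set.Icc b t) :=
    continuousOn_move_time hf [] σ x fun s hs => by
      refine ⟨List.pairwise_cons.2 ⟨fun p hp => (hb p hp).trans hs.1, hσ.1.imp le_of_lt⟩, ?_⟩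
      intro p hp
      rcases List.mem_cons.1 hp with rfl | hp
      · exact ⟨hb0.trans hs.1, hs.2⟩
      · exact ⟨(hσ.2 p hp).1.le, (hσ.2 p hp).2.le⟩
  have hmem : Set.Ioo b t ∈ 𝓝[<] t := Ioo_mem_nhdsLT hbt
  have h1 : Tendsto (fun s => f ((x, s) :: σ)) (𝓝[<] t) (𝓝 (f ((x, t) :: σ))) :=
    (hcont t ⟨hbt.le, le_rfl⟩).mono_left
      (nhdsWithin_le_iff.2 (mem_of_superset hmem Set.Ioo_subset_Icc_self))
  refine h1.congr' ?_
  filter_upwards [hmem] with s hs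
  cases σ with
  | nil => rfl
  | cons q ρ =>
    simp [Config.insert, List.orderedInsert_cons, (hb q (by simp)).trans hs.1.le]

end Insertion

/-! ### The causal product and the closed system for it -/

namespace Model

variable {d : ℕ} {HS : Type*} [NormedAddCommGroup HS] [InnerProductSpace ℂ HS] [CompleteSpace HS]

theorem integrable_corr_mul_exp (M : Model d HS) (a : Fin 2) (E : ℝ) :
    Integrable fun u : ℝ =>
      ⟪M.g a, M.S u (M.g a)⟫_ℂ * Complex.exp (-(Complex.I * (u * E : ℝ))) := by
  refine (M.integrable_corr _ (M.g_mem a) _ (M.g_mem a)).mul_bdd (c := 1)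
    (Continuous.aestronglyMeasurable (by fun_prop)) (ae_of_all _ fun u => ?_)
  rw [Complex.norm_exp]
  simp

/-- The causal product exists and only sees the boundary value of `X` at coinciding times: the
commutator function tends to `γ_a(E) δ_{t-}`. -/
theorem tendsto_annLeftReg (M : Model d HS) {X : M.Kernel} {t : ℝ} (ht : 0 < t)
    {h : M.TestFunction}
    (hX : ∀ (n : ℕ) (x : Fin n → Mode),
      ContinuousOn (fun p : Fin n → ℝ => X h (List.ofFn fun i => (x i, p i)))
        {p | Antitone p ∧ ∀ i, 0 ≤ p i ∧ p i ≤ t})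
    {σ : Config} (hσ : σ.Before t) (a b : Fin 2) (E : ℝ) :
    Tendsto (fun lam => M.annLeftReg lam a b E t X h σ) (𝓝[>] 0)
      (𝓝 (M.γ a E • X h ((⟨a, b, E⟩, t) :: σ) + h.val a b E t • X h σ)) := by
  obtain ⟨hm, C, hC⟩ := aestronglyMeasurable_bounded_insert hX ⟨a, b, E⟩ σ [] t le_rfl
    (hσ.1.imp le_of_lt) (fun p hp => ⟨(hσ.2 p hp).1.le, (hσ.2 p hp).2.le⟩) (by simp)
    (fun p hp => (hσ.2 p hp).2.le)
  have key := tendsto_integral_approx_identity_left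
    (M.integrable_corr_mul_exp a E).integrableOn ht hm hC
    (tendsto_insert_left ht hX ⟨a, b, E⟩ hσ)
  refine Tendsto.add_const _ (key.congr fun c => ?_)
  refine intervalIntegral.integral_congr fun s _ => ?_
  simp only [commutatorFun, mul_assoc, List.nil_append]

theorem IsEvolution.continuousOn_simplex {M : Model d HS} {U : ℝ → M.Kernel} (hU : M.IsEvolution U)
    (h : M.TestFunction) {t : ℝ} (ht : 0 ≤ t) (n : ℕ) (x : Fin n → Mode) :
    ContinuousOn (fun p : Fin n → ℝ => U t h (List.ofFn fun i => (x i, p i)))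
      {p | Antitone p ∧ ∀ i, 0 ≤ p i ∧ p i ≤ t} :=
  (hU.continuousOn h n x).comp (f := fun p : Fin n → ℝ => (t, p)) (by fun_prop)
    fun _ hp => ⟨ht, hp.1, hp.2⟩

theorem IsEvolution.tendsto_annLeft {M : Model d HS} {U : ℝ → M.Kernel} (hU : M.IsEvolution U)
    {t : ℝ} (ht : 0 < t) (h : M.TestFunction) {σ : Config} (hσ : σ.Before t) (a b : Fin 2)
    (E : ℝ) :
    Tendsto (fun lam => M.annLeftReg lam a b E t (U t) h σ) (𝓝[>] 0)
      (𝓝 (M.annLeft a b E t (U t) h σ)) :=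
  tendsto_nhds_limUnder
    ⟨_, M.tendsto_annLeftReg ht (hU.continuousOn_simplex h ht.le) hσ a b E⟩

theorem IsEvolution.annLeft_eq {M : Model d HS} {U : ℝ → M.Kernel} (hU : M.IsEvolution U)
    {t : ℝ} (ht : 0 < t) (h : M.TestFunction) {σ : Config} (hσ : σ.Before t) (a b : Fin 2)
    (E : ℝ) :
    M.annLeft a b E t (U t) h σ =
      M.γ a E • U t h ((⟨a, b, E⟩, t) :: σ) + h.val a b E t • U t h σ :=
  (M.tendsto_annLeftReg ht (hU.continuousOn_simplex h ht.le) hσ a b E).limUnder_eq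

/-- The boundary value of the coefficients at a creator with the final time: the time integral in
the evolution equation is then over an empty interval, and only the creation part of the
Hamiltonian is left. -/
theorem IsEvolution.apply_final_time {M : Model d HS} {U : ℝ → M.Kernel} (hU : M.IsEvolution U)
    {t : ℝ} (ht : 0 < t) (h : M.TestFunction) {σ : Config} (hσ : σ.Before t) (a b : Fin 2)
    (E : ℝ) :
    U t h ((⟨a, b, E⟩, t) :: σ) = -Complex.I • (M.D a * (M.annLeft (1 - a) b E t (U t) h σ +
      if b = 1 - a then M.m b E • U t h σ else 0)) := by
  rw [hU.equation_cons h ⟨a, b, E⟩ t t ht le_rfl σ hσ]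
  fin_cases a <;> fin_cases b <;>
    simp [one, timeIntegral, hamiltonian, sysMul, number, annihilation, creation]

/-- The normally ordered form at a fixed energy, by elimination of `B_{ε,ε}(E,t) U_t` from the
closed system for `B_{1-ε,ε}(E,t) U_t` and `B_{ε,ε}(E,t) U_t`. -/
theorem IsEvolution.normalOrdered_eq {M : Model d HS} {U : ℝ → M.Kernel} (hU : M.IsEvolution U)
    {ε : Fin 2} {E : ℝ} (hT : IsUnit (M.preT ε E))
    {t : ℝ} (ht : 0 < t) (h : M.TestFunction) {σ : Config} (hσ : σ.Before t) :
    M.normalOrdered ε E t (U t) h σ = Complex.I • (M.D ε *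
      (M.annLeft (1 - ε) ε E t (U t) h σ - M.annRight (1 - ε) ε E t (U t) h σ)) := by
  have hε : 1 - (1 - ε) = ε := sub_sub_cancel 1 ε
  have hne : ε ≠ 1 - ε := by fin_cases ε <;> decide
  have h1 := hU.annLeft_eq ht h hσ (1 - ε) ε E
  have h2 := hU.annLeft_eq ht h hσ ε ε E
  rw [hU.apply_final_time ht h hσ, hε, if_pos rfl] at h1
  rw [hU.apply_final_time ht h hσ, if_neg hne, add_zero] at h2
  simp only [annRight, normalOrdered]
  set A := M.annLeft (1 - ε) ε E t (U t) h σ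
  set B := M.annLeft ε ε E t (U t) h σ
  set X := U t h σ
  set V := h.val (1 - ε) ε E t
  set W := h.val ε ε E t
  have hT' : M.T ε E * M.preT ε E = 1 := Ring.inverse_mul_cancel _ hT
  -- `D_ε D_{1-ε}` commutes with `preT`, hence with its inverse.
  have hcomm : Commute (M.D ε * M.D (1 - ε)) (M.T ε E) := by
    rw [T, Ring.inverse_of_isUnit hT]
    refine Commute.units_inv_right ?_
    rw [IsUnit.unit_spec]
    exact (Commute.one_right _).add_right ((Commute.refl _).smul_right _)
  -- The closed system, multiplied by `D_ε`; this turns `1 + γ γ D_{1-ε} D_ε` into `preT`.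
  have hsys : M.preT ε E * (M.D ε * (A - V • X)) = -Complex.I • M.γ (1 - ε) E •
      (M.D ε * M.D (1 - ε) * (M.m ε E • X - Complex.I • (M.D ε * (M.γ ε E • V • X)) + W • X)) := by
    have h3 : M.D ε * (A - V • X) =
        M.γ (1 - ε) E • -Complex.I • (M.D ε * (M.D (1 - ε) * (B + M.m ε E • X))) := by
      rw [h1, add_sub_cancel_right, mul_smul_comm, mul_smul_comm]
    rw [preT, add_mul, one_mul]
    nth_rewrite 1 [h3]
    rw [h2]
    simp only [mul_add, mul_sub, mul_smul_comm, smul_mul_assoc, mul_assoc]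
    match_scalars <;> ring_nf <;> simp [Complex.I_sq]
  have hsol : M.D ε * (A - V • X) = M.T ε E * (M.preT ε E * (M.D ε * (A - V • X))) := by
    rw [← mul_assoc, hT', one_mul]
  rw [hsol, hsys, hcomm.eq]
  simp only [mul_smul_comm, smul_mul_assoc, mul_assoc, smul_smul]
  rw [neg_mul, mul_neg, ← mul_assoc Complex.I Complex.I, Complex.I_mul_I, neg_mul, neg_neg, one_mul]

end Model

end LowDensity

theorem theorem2 {d : ℕ} {HS : Type*} [NormedAddCommGroup HS] [InnerProductSpace ℂ HS]
    [CompleteSpace HS] (M : LowDensity.Model d HS)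
    (hT : ∀ (ε : Fin 2) (E : ℝ), IsUnit (M.preT ε E))
    (U : ℝ → M.Kernel) (hU : M.IsEvolution U)
    (ε : Fin 2) (t : ℝ) (ht : 0 < t)
    (h : M.TestFunction) (σ : LowDensity.Config) (hσ : σ.Before t) :
    (∀ (a b : Fin 2) (E : ℝ), Tendsto (fun lam => M.annLeftReg lam a b E t (U t) h σ)
      (𝓝[>] 0) (𝓝 (M.annLeft a b E t (U t) h σ))) ∧
    Integrable (fun E : ℝ =>
      M.annLeft (1 - ε) ε E t (U t) h σ - M.annRight (1 - ε) ε E t (U t) h σ) ∧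
    Integrable (fun E : ℝ => M.normalOrdered ε E t (U t) h σ) ∧
    (-Complex.I) • (M.D ε *
        (M.annLeftTotal (1 - ε) ε t (U t) h σ - M.annRightTotal (1 - ε) ε t (U t) h σ)) =
      -∫ E : ℝ, M.normalOrdered ε E t (U t) h σ := by
  have hC : Integrable fun E : ℝ =>
      M.annLeft (1 - ε) ε E t (U t) h σ - M.annRight (1 - ε) ε E t (U t) h σ :=
    (hU.integrable h ε t ht σ hσ).sub ((h.integrable (1 - ε) ε t).smul_const _)
  have hN : (fun E : ℝ => M.normalOrdered ε E t (U t) h σ) = fun E => Complex.I • (M.D ε *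
      (M.annLeft (1 - ε) ε E t (U t) h σ - M.annRight (1 - ε) ε E t (U t) h σ)) :=
    funext fun E => hU.normalOrdered_eq (hT ε E) ht h hσ
  refine ⟨hU.tendsto_annLeft ht h hσ, hC, ?_, ?_⟩
  · rw [hN]
    exact (hC.const_mul (M.D ε)).smul Complex.I
  · rw [hN, integral_smul, integral_const_mul_of_integrable hC, neg_smul]
    congr 3
    exact (integral_sub (hU.integrable h ε t ht σ hσ)
      ((h.integrable (1 - ε) ε t).smul_const _)).symm
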